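/- A \emph{tree} here is an infinite, locally finite tree; $m(x)$ is the valence of a vertex $x$, $d$ is the graph distance, $S_r(x_0)=\{x : d(x_0,x)=r\}$, $B_r(x_0)=\{x : d(x_0,x)\le r\}$, and $\Delta f(x)=\sum_{y\sim x}(f(x)-f(y))$. The \emph{heat kernel} is $p_t(x,y)=\lim_{R\to\infty}p^R_t(x,y)$ for $t\ge 0$, where $p^R_t(x,y)=\sum_i e^{-\lambda_i t}\phi_i(x)\phi_i(y)$ is the Dirichlet heat kernel of the ball $B_R(x_0)$ about a fixed vertex $x_0$: the $\phi_i$ are an orthonormal basis, consisting of eigenfunctions with eigenvalues $\lambda_i$, for the reduced Laplacian on the functions on $B_R(x_0)$ that vanish at the vertices of $B_R(x_0)$ having a neighbour outside $B_R(x_0)$; $p^R_t$ is extended by $0$. The \emph{model tree} $T_n$ is a tree with a root whose valence is $n(0)$ and in which every vertex at distance $r>0$ from the root has valence $n(r)+1$. Theorem. Let $T_n$ be a model tree with root $o$ and heat kernel $\rho_t(\cdot,\cdot)$, and let $T$ be a tree with a vertex $x_0$ and heat kernel $p_t(\cdot,\cdot)$. For each $t \ge 0$ and $r \ge 0$, $\rho_t(o,y)$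 has the same value, denoted $\rho_t(r)$, for all $y\in S_r(o)\subset T_n$. Put $M(r)=\max_{x\in S_r(x_0)}m(x)$ for the tree $T$, and assume that $m(x_0)\le n(0)$ and that $M(r)\le n(r)+1$ for all $r>0$. Then \[ \rho_t(r)\le p_t(x_0,x)\qquad\text{for all } t\ge 0,\ r\ge 0 \text{ and } x\in S_r(x_0)\subset T. \] -/

import Mathlib

namespace GraphHeat

variable {V : Type*} (G : SimpleGraph V) [G.LocallyFinite]

/-- The combinatorial Laplacian `Δ f (x) = ∑_{y ∼ x} (f x - f y)`. -/
noncomputable def laplacian (f : V → ℝ) (x : V) : ℝ :=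
  ∑ y ∈ G.neighborFinset x, (f x - f y)

open Classical in
/-- The matrix coefficients of the Laplacian. -/
theorem laplacian_single (x y : V) :
    laplacian G (Pi.single y 1) x =
      if x = y then (G.degree x : ℝ) else if G.Adj x y then -1 else 0 := by
  unfold laplacian
  rw [Finset.sum_sub_distrib]
  by_cases h : x = y
  · subst h
    simp [Pi.single_apply]
  · simp [Pi.single_apply, h]
    split_ifs <;> simp

/-- In a locally finite graph, closed balls of finite radius are finite. -/
theorem finite_closedBall (x₀ : V) (r : ℕ) : {x : V | G.edist x₀ x ≤ r}.Finite := by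
  induction r with
  | zero =>
    refine (Set.finite_singleton x₀).subset ?_
    intro x hx
    have hx' : G.edist x₀ x ≤ ((0 : ℕ) : ℕ∞) := hx
    have h : G.edist x₀ x = 0 := le_antisymm (by simpa using hx') zero_le
    exact (SimpleGraph.edist_eq_zero_iff.mp h).symm
  | succ r ih =>
    refine (ih.union (ih.biUnion fun z _ => (G.neighborSet z).toFinite)).subset ?_
    intro x hx
    have hx' : G.edist x₀ x ≤ ((r + 1 : ℕ) : ℕ∞) := hx
    by_cases hr : G.edist x₀ x ≤ r
    · exact Or.inl hr
    · right
      have hx1 : G.edist x x₀ ≤ ((r + 1 : ℕ) : ℕ∞) := by rwa [SimpleGraph.edist_comm]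
      obtain ⟨p, hp⟩ := SimpleGraph.exists_walk_of_edist_ne_top
        (ne_top_of_le_ne_top (ENat.natCast_ne_top _) hx1)
      rw [← hp] at hx1
      have hlen : p.length ≤ r + 1 := by exact_mod_cast hx1
      cases p with
      | nil => exact absurd (by simp) hr
      | cons h q =>
        rename_i z
        simp only [SimpleGraph.Walk.length_cons] at hlen
        refine Set.mem_biUnion (x := z) ?_ h.symm
        change G.edist x₀ z ≤ r
        rw [SimpleGraph.edist_comm]
        exact (SimpleGraph.edist_le q).trans (by exact_mod_cast Nat.le_of_succ_le_succ hlen)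

/-- The ball `B_r(x₀) = {x | d(x₀, x) ≤ r}`. -/
noncomputable def ball (x₀ : V) (r : ℕ) : Finset V := (finite_closedBall G x₀ r).toFinset

/-- The sphere `S_r(x₀) = {x | d(x₀, x) = r}`. -/
noncomputable def sphere (x₀ : V) (r : ℕ) : Finset V :=
  (ball G x₀ r).filter fun x => G.dist x₀ x = r

/-- `M(r)`: the maximum of the valence over the sphere `S_r(x₀)`. -/
noncomputable def maxValence (x₀ : V) (r : ℕ) : ℕ :=
  (sphere G x₀ r).sup fun x => G.degree x

open Classical in
/-- The interior of `D`: the vertices of `D` with no neighbour outside `D`. -/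
noncomputable def interior (D : Finset V) : Finset V :=
  D.filter fun x => ∀ y, G.Adj x y → y ∈ D

open Classical in
/-- The matrix of the reduced (Dirichlet) Laplacian of `D`, acting on the functions on `D` that
vanish on the boundary of `D`, that is, on the functions on the interior of `D`. -/
noncomputable def reducedLaplacian (D : Finset V) :
    Matrix (interior G D) (interior G D) ℝ :=
  Matrix.of fun x y => laplacian G (Pi.single (y : V) 1) x

theorem reducedLaplacian_isHermitian (D : Finset V) : (reducedLaplacian G D).IsHermitian := by
  ext x y
  simp only [reducedLaplacian, Matrix.conjTranspose_apply, Matrix.of_apply, laplacian_single,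
    star_trivial]
  by_cases h : (x : V) = y
  · have hxy : x = y := Subtype.ext h
    subst hxy
    rfl
  · have h' : ¬ (y : V) = x := fun e => h e.symm
    rw [if_neg h, if_neg h', G.adj_comm]

open Classical in
/-- The Dirichlet heat kernel of `D`: the eigenfunction expansion
`∑ i, exp (-λ i * t) * φ i x * φ i y` over an orthonormal basis of eigenfunctions `φ i` of the
reduced Laplacian with eigenvalues `λ i`, extended by zero. -/
noncomputable def dirichletHeatKernel (D : Finset V) (t : ℝ) (x y : V) : ℝ :=
  if h : x ∈ interior G D ∧ y ∈ interior G D then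
    ∑ i, Real.exp (-(reducedLaplacian_isHermitian G D).eigenvalues i * t) *
      (reducedLaplacian_isHermitian G D).eigenvectorBasis i ⟨x, h.1⟩ *
      (reducedLaplacian_isHermitian G D).eigenvectorBasis i ⟨y, h.2⟩
  else 0

/-- The heat kernel `p_t(x, y)`: the limit of the Dirichlet heat kernels of the balls
`B_R(x₀)` as `R → ∞`. -/
noncomputable def heatKernel (x₀ : V) (t : ℝ) (x y : V) : ℝ :=
  Filter.limUnder Filter.atTop fun R : ℕ => dirichletHeatKernel G (ball G x₀ R) t x y

/-- `G` is the model tree `T_n` with root `o` and branching function `n`: the root has valence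
`n 0`, and every vertex at distance `r > 0` from the root has valence `n r + 1`. -/
structure IsModelTree (o : V) (n : ℕ → ℕ) : Prop where
  isTree : G.IsTree
  degree_root : G.degree o = n 0
  degree_eq : ∀ x : V, 0 < G.dist o x → G.degree x = n (G.dist o x) + 1

end GraphHeat

namespace GraphHeat

/-! For every `c`, `exp (-tΔ) = exp (-ct) exp (t(c - Δ))`. If `c` bounds the valences on the ball,
`c - Δ` with Dirichlet conditions has nonnegative entries, so for `t ≥ 0` Dirichlet kernels can be
compared term by term through the iterates `(c - Δ)^k δ` at the root (`hasSum_dirichletHeatKernel`,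
`dirichletHeatKernel_le`).

On the model tree these iterates are radial, and for large `c` they decrease with the distance to
the root (`radialIter_antitone`). A vertex with fewer children sees fewer of the smaller outer
values, so on `T` the operator `c - Δ` sends the same radial profile to something at least as large.
Positivity carries this through the induction on `k` (`radialIter_le_heatIter`).

Kernels of growing balls increase and are at most 1, so the inequality passes to the limit
(`tendsto_dirichletHeatKernel`, `heatKernel_model_le`). -/

theorem interior_mono {V : Type*} (G : SimpleGraph V) {D E : Finset V} (h : D ⊆ E) :
    interior G D ⊆ interior G E := by
  intro x hx
  simp only [interior, Finset.mem_filter] at hx ⊢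
  exact ⟨h hx.1, fun y hy => h (hx.2 y hy)⟩

/-! ### Dirichlet heat kernels as exponential series -/

section Kernel

variable {V : Type*} (G : SimpleGraph V) [G.LocallyFinite]

theorem laplacian_sum {ι : Type*} (s : Finset ι) (a : ι → ℝ) (f : ι → V → ℝ) (x : V) :
    laplacian G (fun z => ∑ i ∈ s, a i * f i z) x = ∑ i ∈ s, a i * laplacian G (f i) x := by
  simp only [laplacian, Finset.mul_sum, ← Finset.sum_sub_distrib, ← mul_sub]
  exact Finset.sum_comm

/-- Displays the coefficients of `c - Δ`, all nonnegative once `c` is at least the valence. -/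
theorem mul_sub_laplacian (c : ℝ) (f : V → ℝ) (x : V) :
    c * f x - laplacian G f x = (c - G.degree x) * f x + ∑ y ∈ G.neighborFinset x, f y := by
  simp only [laplacian, Finset.sum_sub_distrib, Finset.sum_const,
    SimpleGraph.card_neighborFinset_eq_degree, nsmul_eq_mul]
  ring

open Classical in
/-- The operator `c - Δ` with Dirichlet boundary conditions on `D`. -/
noncomputable def heatStep (c : ℝ) (D : Finset V) (f : V → ℝ) (x : V) : ℝ :=
  if x ∈ interior G D then c * f x - laplacian G f x else 0

open Classical in
/-- The iterates `(c - Δ)^k δ_y` with Dirichlet boundary conditions on `D`. -/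
noncomputable def heatIter (c : ℝ) (D : Finset V) (y : V) (k : ℕ) : V → ℝ :=
  (heatStep G c D)^[k] (Pi.single y 1)

theorem heatIter_succ (c : ℝ) (D : Finset V) (y : V) (k : ℕ) :
    heatIter G c D y (k + 1) = heatStep G c D (heatIter G c D y k) :=
  Function.iterate_succ_apply' _ _ _

theorem heatStep_sum (c : ℝ) (D : Finset V) {ι : Type*} (s : Finset ι) (a : ι → ℝ)
    (f : ι → V → ℝ) :
    heatStep G c D (fun z => ∑ i ∈ s, a i * f i z) =
      fun z => ∑ i ∈ s, a i * heatStep G c D (f i) z := by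
  ext x
  unfold heatStep
  split_ifs
  · rw [laplacian_sum, Finset.mul_sum, ← Finset.sum_sub_distrib]
    exact Finset.sum_congr rfl fun i _ => by ring
  · simp

open Classical in
/-- The `i`-th Dirichlet eigenfunction of `D`, extended by zero. -/
noncomputable def eigenfunction (D : Finset V) (i : interior G D) (x : V) : ℝ :=
  if h : x ∈ interior G D then
    (reducedLaplacian_isHermitian G D).eigenvectorBasis i ⟨x, h⟩ else 0

open Classical in
-- The zero extension is a combination of point masses at interior vertices, so the matrix
-- eigenvalue equation computes its Laplacian there. The equation may fail elsewhere, hence the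
-- cut-off in `heatStep`.
theorem laplacian_eigenfunction (D : Finset V) (i : interior G D) {x : V}
    (hx : x ∈ interior G D) :
    laplacian G (eigenfunction G D i) x =
      (reducedLaplacian_isHermitian G D).eigenvalues i * eigenfunction G D i x := by
  have h := congrFun ((reducedLaplacian_isHermitian G D).mulVec_eigenvectorBasis i) ⟨x, hx⟩
  have hf : eigenfunction G D i = fun z => ∑ y : interior G D,
      (reducedLaplacian_isHermitian G D).eigenvectorBasis i y *
        (Pi.single (y : V) 1 : V → ℝ) z := by
    ext z
    by_cases hz : z ∈ interior G D
    · rw [Finset.sum_eq_single ⟨z, hz⟩]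
      · simp [eigenfunction, hz]
      · intro y _ hy
        rw [Pi.single_apply, if_neg, mul_zero]
        exact fun e => hy (Subtype.ext e.symm)
      · simp
    · rw [Finset.sum_eq_zero]
      · simp [eigenfunction, hz]
      · intro y _
        rw [Pi.single_apply, if_neg, mul_zero]
        exact fun e => hz (e ▸ y.2)
  have hx' : eigenfunction G D i x =
      (reducedLaplacian_isHermitian G D).eigenvectorBasis i ⟨x, hx⟩ := by
    simp [eigenfunction, hx]
  rw [hx', hf, laplacian_sum]
  simp only [Matrix.mulVec, dotProduct, Pi.smul_apply, smul_eq_mul, reducedLaplacian,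
    Matrix.of_apply] at h
  refine Eq.trans (Finset.sum_congr rfl fun y _ => mul_comm _ _) h

open Classical in
theorem heatStep_eigenfunction (c : ℝ) (D : Finset V) (i : interior G D) (x : V) :
    heatStep G c D (eigenfunction G D i) x =
      (c - (reducedLaplacian_isHermitian G D).eigenvalues i) * eigenfunction G D i x := by
  by_cases hx : x ∈ interior G D
  · rw [heatStep, if_pos hx, laplacian_eigenfunction G D i hx]
    ring
  · simp [heatStep, eigenfunction, hx]

open Classical in
theorem sum_eigenfunction_mul (D : Finset V) {y : V} (hy : y ∈ interior G D) :
    (Pi.single y 1 : V → ℝ) = fun x => ∑ i, eigenfunction G D i y * eigenfunction G D i x := by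
  ext x
  by_cases hx : x ∈ interior G D
  · have h := congrArg (fun v : EuclideanSpace ℝ (interior G D) => v ⟨x, hx⟩)
      ((reducedLaplacian_isHermitian G D).eigenvectorBasis.sum_repr'
        (EuclideanSpace.single (⟨y, hy⟩ : interior G D) (1 : ℝ)))
    simp only [WithLp.ofLp_sum, Finset.sum_apply, PiLp.smul_apply, smul_eq_mul,
      EuclideanSpace.inner_single_right, one_mul, conj_trivial, PiLp.single_apply,
      Subtype.mk.injEq] at h
    simp only [eigenfunction, hx, hy, dif_pos, Pi.single_apply]
    exact h.symm
  · have : x ≠ y := fun e => hx (e ▸ hy)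
    simp [eigenfunction, hx, this]

open Classical in
theorem heatIter_eq_sum (c : ℝ) (D : Finset V) {y : V} (hy : y ∈ interior G D) (k : ℕ) :
    heatIter G c D y k = fun x => ∑ i,
      ((c - (reducedLaplacian_isHermitian G D).eigenvalues i) ^ k * eigenfunction G D i y) *
        eigenfunction G D i x := by
  induction k with
  | zero => simpa [heatIter] using sum_eigenfunction_mul G D hy
  | succ k ih =>
    rw [heatIter_succ, ih, heatStep_sum]
    ext x
    refine Finset.sum_congr rfl fun i _ => ?_
    rw [heatStep_eigenfunction]
    ring

/-- The Dirichlet heat kernel as the exponential series of `c - Δ`. -/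
theorem hasSum_dirichletHeatKernel (c : ℝ) (D : Finset V) (t : ℝ) {y : V}
    (hy : y ∈ interior G D) (x : V) :
    HasSum (fun k : ℕ => Real.exp (-(c * t)) * (t ^ k / k.factorial * heatIter G c D y k x))
      (dirichletHeatKernel G D t y x) := by
  classical
  have hker : dirichletHeatKernel G D t y x = Real.exp (-(c * t)) * ∑ i,
      Real.exp (t * (c - (reducedLaplacian_isHermitian G D).eigenvalues i)) *
        (eigenfunction G D i y * eigenfunction G D i x) := by
    by_cases hx : x ∈ interior G D
    · rw [dirichletHeatKernel, dif_pos ⟨hy, hx⟩, Finset.mul_sum]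
      refine Finset.sum_congr rfl fun i _ => ?_
      simp only [eigenfunction, hx, hy, dif_pos]
      rw [← mul_assoc, ← Real.exp_add, mul_assoc]
      congr 2
      ring
    · simp [dirichletHeatKernel, eigenfunction, hx]
  rw [hker]
  refine HasSum.mul_left _ ?_
  have h : ∀ i ∈ (Finset.univ : Finset (interior G D)), HasSum (fun k : ℕ =>
      (t * (c - (reducedLaplacian_isHermitian G D).eigenvalues i)) ^ k / k.factorial *
        (eigenfunction G D i y * eigenfunction G D i x))
      (Real.exp (t * (c - (reducedLaplacian_isHermitian G D).eigenvalues i)) *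
        (eigenfunction G D i y * eigenfunction G D i x)) := fun i _ => by
    refine HasSum.mul_right _ ?_
    rw [Real.exp_eq_exp_ℝ]
    exact NormedSpace.expSeries_div_hasSum_exp _
  refine (hasSum_sum h).congr_fun fun k => ?_
  rw [heatIter_eq_sum G c D hy k, Finset.mul_sum]
  refine Finset.sum_congr rfl fun i _ => ?_
  rw [mul_pow]
  ring

/-- Comparison of Dirichlet heat kernels by comparison of the iterates of `c - Δ`. -/
theorem dirichletHeatKernel_le {W : Type*} (H : SimpleGraph W) [H.LocallyFinite] (c : ℝ)
    {D : Finset V} {E : Finset W} {t : ℝ} (ht : 0 ≤ t) {y x : V} {w z : W}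
    (hy : y ∈ interior G D) (hw : w ∈ interior H E)
    (h : ∀ k, heatIter G c D y k x ≤ heatIter H c E w k z) :
    dirichletHeatKernel G D t y x ≤ dirichletHeatKernel H E t w z :=
  hasSum_le (fun k => mul_le_mul_of_nonneg_left
    (mul_le_mul_of_nonneg_left (h k) (by positivity)) (Real.exp_nonneg _))
    (hasSum_dirichletHeatKernel G c D t hy x) (hasSum_dirichletHeatKernel H c E t hw z)

/-! ### Positivity, domain monotonicity and bounds -/

theorem heatIter_nonneg {c : ℝ} {D : Finset V} (hc : ∀ x ∈ D, (G.degree x : ℝ) ≤ c) (y : V)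
    (k : ℕ) (x : V) : 0 ≤ heatIter G c D y k x := by
  classical
  induction k generalizing x with
  | zero =>
    simp only [heatIter, Function.iterate_zero, id, Pi.single_apply]
    split_ifs <;> norm_num
  | succ k ih =>
    rw [heatIter_succ, heatStep]
    split_ifs with hx
    · rw [mul_sub_laplacian]
      have := hc x (Finset.mem_filter.mp hx).1
      exact add_nonneg (mul_nonneg (by linarith) (ih x)) (Finset.sum_nonneg fun z _ => ih z)
    · exact le_rfl

theorem heatIter_mono {c : ℝ} {D E : Finset V} (hDE : D ⊆ E)
    (hc : ∀ x ∈ E, (G.degree x : ℝ) ≤ c) (y : V)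
    (k : ℕ) (x : V) : heatIter G c D y k x ≤ heatIter G c E y k x := by
  classical
  induction k generalizing x with
  | zero => exact le_rfl
  | succ k ih =>
    by_cases hx : x ∈ interior G D
    · rw [heatIter_succ, heatIter_succ, heatStep, heatStep, if_pos hx,
        if_pos (interior_mono G hDE hx), mul_sub_laplacian, mul_sub_laplacian]
      have := hc x (hDE (Finset.mem_filter.mp hx).1)
      exact add_le_add (mul_le_mul_of_nonneg_left (ih x) (by linarith))
        (Finset.sum_le_sum fun z _ => ih z)
    · rw [heatIter_succ, heatStep, if_neg hx]
      exact heatIter_nonneg G hc y _ x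

/-- The coefficients of `c - Δ` at a vertex are nonnegative and sum to `c`. -/
theorem heatIter_le_pow {c : ℝ} (hc₀ : 0 ≤ c) {D : Finset V}
    (hc : ∀ x ∈ D, (G.degree x : ℝ) ≤ c) (y : V)
    (k : ℕ) (x : V) : heatIter G c D y k x ≤ c ^ k := by
  classical
  induction k generalizing x with
  | zero =>
    simp only [heatIter, Function.iterate_zero, id, Pi.single_apply, pow_zero]
    split_ifs <;> norm_num
  | succ k ih =>
    rw [heatIter_succ, heatStep]
    split_ifs with hx
    · rw [mul_sub_laplacian]
      have := hc x (Finset.mem_filter.mp hx).1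
      calc _ ≤ (c - G.degree x) * c ^ k + ∑ z ∈ G.neighborFinset x, c ^ k :=
            add_le_add (mul_le_mul_of_nonneg_left (ih x) (by linarith))
              (Finset.sum_le_sum fun z _ => ih z)
        _ = c ^ (k + 1) := by
          simp only [Finset.sum_const, SimpleGraph.card_neighborFinset_eq_degree, nsmul_eq_mul]
          ring
    · positivity

theorem dirichletHeatKernel_le_one (D : Finset V) {t : ℝ} (ht : 0 ≤ t) {y : V}
    (hy : y ∈ interior G D) (x : V) : dirichletHeatKernel G D t y x ≤ 1 := by
  set c : ℝ := ∑ z ∈ D, (G.degree z : ℝ) with hcdef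
  have hc : ∀ z ∈ D, (G.degree z : ℝ) ≤ c := fun z hz =>
    Finset.single_le_sum (f := fun z => (G.degree z : ℝ)) (fun _ _ => Nat.cast_nonneg _) hz
  have hc₀ : 0 ≤ c := Finset.sum_nonneg fun _ _ => Nat.cast_nonneg _
  -- The majorant series sums to `exp (-ct) exp (tc) = 1`.
  have h1 : HasSum (fun k : ℕ => Real.exp (-(c * t)) * (t ^ k / k.factorial * c ^ k)) 1 := by
    have := (NormedSpace.expSeries_div_hasSum_exp (𝔸 := ℝ) (t * c)).mul_left (Real.exp (-(c * t)))
    rw [← Real.exp_eq_exp_ℝ, ← Real.exp_add] at this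
    rw [show -(c * t) + t * c = 0 by ring, Real.exp_zero] at this
    refine this.congr_fun fun k => ?_
    rw [mul_pow]
    ring
  exact hasSum_le (fun k => mul_le_mul_of_nonneg_left
    (mul_le_mul_of_nonneg_left (heatIter_le_pow G hc₀ hc y k x) (by positivity))
    (Real.exp_nonneg _)) (hasSum_dirichletHeatKernel G c D t hy x) h1

theorem dirichletHeatKernel_mono {D E : Finset V} (hDE : D ⊆ E) {t : ℝ} (ht : 0 ≤ t) {y : V}
    (hy : y ∈ interior G D) (x : V) :
    dirichletHeatKernel G D t y x ≤ dirichletHeatKernel G E t y x :=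
  dirichletHeatKernel_le G G (∑ z ∈ E, (G.degree z : ℝ)) ht hy (interior_mono G hDE hy) fun k =>
    heatIter_mono G hDE (fun _ hz => Finset.single_le_sum (f := fun z => (G.degree z : ℝ))
      (fun _ _ => Nat.cast_nonneg _) hz) y k x

/-! ### Balls and the limit over exhausting balls -/

theorem mem_ball {x₀ x : V} {r : ℕ} : x ∈ ball G x₀ r ↔ G.edist x₀ x ≤ r := by
  simp [ball]

theorem ball_mono (x₀ : V) {r s : ℕ} (h : r ≤ s) : ball G x₀ r ⊆ ball G x₀ s := by
  intro x hx
  rw [mem_ball] at hx ⊢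
  exact hx.trans (by exact_mod_cast h)

theorem mem_interior_ball_of_edist_lt {x₀ x : V} {r : ℕ} (h : G.edist x₀ x < r) :
    x ∈ interior G (ball G x₀ r) := by
  simp only [interior, Finset.mem_filter, mem_ball]
  refine ⟨h.le, fun y hy => ?_⟩
  calc G.edist x₀ y ≤ G.edist x₀ x + G.edist x y := G.edist_triangle
    _ = G.edist x₀ x + 1 := by rw [SimpleGraph.edist_eq_one_iff_adj.mpr hy]
    _ ≤ r := Order.add_one_le_of_lt h

open Filter Topology in
-- Monotone bounded convergence makes the `limUnder` in `heatKernel` a genuine limit. Radii are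
-- shifted by one so that the centre is interior.
theorem tendsto_dirichletHeatKernel (x₀ : V) {t : ℝ} (ht : 0 ≤ t) (x : V) :
    Tendsto (fun R : ℕ => dirichletHeatKernel G (ball G x₀ R) t x₀ x) atTop
      (𝓝 (heatKernel G x₀ t x₀ x)) := by
  have hmem : ∀ R : ℕ, x₀ ∈ interior G (ball G x₀ (R + 1)) := fun R =>
    mem_interior_ball_of_edist_lt G (by simp)
  have hmono : Monotone fun R : ℕ => dirichletHeatKernel G (ball G x₀ (R + 1)) t x₀ x :=
    fun R S hRS => dirichletHeatKernel_mono G (ball_mono G x₀ (by omega)) ht (hmem R) x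
  have hbdd : BddAbove (Set.range fun R : ℕ =>
      dirichletHeatKernel G (ball G x₀ (R + 1)) t x₀ x) := by
    refine ⟨1, ?_⟩
    rintro _ ⟨R, rfl⟩
    exact dirichletHeatKernel_le_one G _ ht (hmem R) x
  exact tendsto_nhds_limUnder
    ⟨_, (tendsto_add_atTop_iff_nat 1).mp (tendsto_atTop_ciSup hmono hbdd)⟩

end Kernel

/-! ### Distance to the root in a tree -/

section Tree

variable {V : Type*} {G : SimpleGraph V}

theorem mem_ball_iff_dist [G.LocallyFinite] (hG : G.Connected) {x₀ x : V} {r : ℕ} :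
    x ∈ ball G x₀ r ↔ G.dist x₀ x ≤ r := by
  rw [mem_ball, ← (hG x₀ x).coe_dist_eq_edist, Nat.cast_le]

theorem mem_sphere_iff_dist [G.LocallyFinite] (hG : G.Connected) {x₀ x : V} {r : ℕ} :
    x ∈ sphere G x₀ r ↔ G.dist x₀ x = r := by
  rw [sphere, Finset.mem_filter, mem_ball_iff_dist hG]
  exact ⟨fun h => h.2, fun h => ⟨h.le, h⟩⟩

theorem mem_interior_ball_of_dist_lt [G.LocallyFinite] (hG : G.Connected) {x₀ x : V} {r : ℕ}
    (h : G.dist x₀ x < r) : x ∈ interior G (ball G x₀ r) :=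
  mem_interior_ball_of_edist_lt G (by
    rw [← (hG x₀ x).coe_dist_eq_edist]
    exact_mod_cast h)

theorem exists_adj_dist_add_one_eq (hG : G.Connected) {o x : V} (hx : G.dist o x ≠ 0) :
    ∃ y, G.Adj x y ∧ G.dist o y + 1 = G.dist o x := by
  obtain ⟨p, hp⟩ := hG.exists_walk_length_eq_dist x o
  cases p with
  | nil => simp at hx
  | cons h q =>
    rename_i z
    refine ⟨z, h, ?_⟩
    have h1 := SimpleGraph.dist_le q
    have h2 := hG.dist_triangle (u := o) (v := z) (w := x)
    rw [SimpleGraph.dist_eq_one_iff_adj.mpr h.symm] at h2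
    rw [SimpleGraph.Walk.length_cons, G.dist_comm] at hp
    rw [G.dist_comm] at h1
    omega

/-- Two parents of `x` would give two geodesics from `o` to `x`; by uniqueness of paths their
penultimate vertices agree. -/
theorem eq_of_adj_of_dist_add_one_eq (hG : G.IsTree) {o x y z : V} (hy : G.Adj x y)
    (hz : G.Adj x z) (hy' : G.dist o y + 1 = G.dist o x) (hz' : G.dist o z + 1 = G.dist o x) :
    y = z := by
  obtain ⟨p, hp⟩ := hG.connected.exists_walk_length_eq_dist o y
  obtain ⟨q, hq⟩ := hG.connected.exists_walk_length_eq_dist o z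
  have hp' : (p.concat hy.symm).IsPath :=
    SimpleGraph.Walk.isPath_of_length_eq_dist _ (by simp [hp, hy'])
  have hq' : (q.concat hz.symm).IsPath :=
    SimpleGraph.Walk.isPath_of_length_eq_dist _ (by simp [hq, hz'])
  have h := congrArg SimpleGraph.Walk.penultimate ((hG.existsUnique_path o x).unique hp' hq')
  simpa using h

/-- Every distance from `o` is attained in an infinite, locally finite, connected graph. -/
theorem exists_dist_eq [Infinite V] [G.LocallyFinite] (hG : G.Connected) (o : V) (r : ℕ) :
    ∃ x, G.dist o x = r := by
  obtain ⟨x, hx⟩ := Infinite.exists_notMem_finset (ball G o r)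
  rw [mem_ball_iff_dist hG, not_le] at hx
  have key : ∀ m, ∀ y, G.dist o y = r + m → ∃ x, G.dist o x = r := by
    intro m
    induction m with
    | zero => exact fun y hy => ⟨y, hy⟩
    | succ m ih =>
      intro y hy
      obtain ⟨z, -, hz⟩ := exists_adj_dist_add_one_eq hG (o := o) (x := y) (by omega)
      exact ih z (by omega)
  exact key (G.dist o x - r) x (by omega)

/-- A vertex `x` of a tree, with `k` neighbours farther from the root `o` than itself, has one
neighbour closer to `o`, unless it is `o`. -/
theorem sum_neighbor_dist [G.LocallyFinite] (hG : G.IsTree) (o x : V) {k : ℕ}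
    (hk : G.degree x = if G.dist o x = 0 then k else k + 1) (a : ℕ → ℝ) :
    ∑ y ∈ G.neighborFinset x, a (G.dist o y) =
      k * a (G.dist o x + 1) + if G.dist o x = 0 then 0 else a (G.dist o x - 1) := by
  classical
  by_cases h0 : G.dist o x = 0
  · rw [if_pos h0] at hk ⊢
    rw [add_zero, ← hk, ← SimpleGraph.card_neighborFinset_eq_degree, ← nsmul_eq_mul]
    refine Finset.sum_eq_card_nsmul fun y hy => ?_
    have := hG.dist_eq_dist_add_one_of_adj o ((G.mem_neighborFinset x y).mp hy)
    congr 1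
    omega
  · rw [if_neg h0] at hk ⊢
    obtain ⟨z, hz, hz'⟩ := exists_adj_dist_add_one_eq hG.connected h0
    have hzm : z ∈ G.neighborFinset x := (G.mem_neighborFinset x z).mpr hz
    rw [← Finset.sum_erase_add _ _ hzm, show G.dist o z = G.dist o x - 1 by omega]
    congr 1
    have hcard : ((G.neighborFinset x).erase z).card = k := by
      rw [Finset.card_erase_of_mem hzm, SimpleGraph.card_neighborFinset_eq_degree, hk]
      rfl
    rw [← hcard, ← nsmul_eq_mul]
    refine Finset.sum_eq_card_nsmul fun y hy => ?_
    rw [Finset.mem_erase, G.mem_neighborFinset] at hy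
    have := hG.dist_eq_dist_add_one_of_adj o hy.2
    rcases this with h | h
    · exact absurd (eq_of_adj_of_dist_add_one_eq hG hy.2 hz h.symm hz') hy.1
    · rw [h]

/-- One formula serves the root as well: there `0 - 1 = 0` in `ℕ`, so the parent term vanishes. -/
theorem laplacian_comp_dist [G.LocallyFinite] (hG : G.IsTree) (o x : V) {k : ℕ}
    (hk : G.degree x = if G.dist o x = 0 then k else k + 1) (a : ℕ → ℝ) :
    laplacian G (fun y => a (G.dist o y)) x =
      k * (a (G.dist o x) - a (G.dist o x + 1)) + (a (G.dist o x) - a (G.dist o x - 1)) := by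
  have h := mul_sub_laplacian G 0 (fun y => a (G.dist o y)) x
  rw [sum_neighbor_dist hG o x hk, hk] at h
  split_ifs at h with h0
  · rw [h0] at h ⊢
    simp only [Nat.zero_sub]
    linarith
  · push_cast at h
    linarith

/-! ### Radial iterates and comparison of trees -/

/-- The operator `c - Δ` on radial functions of the model tree with branching function `n`, with
Dirichlet boundary conditions at distance `R` from the root. -/
noncomputable def radialStep (c : ℝ) (n : ℕ → ℕ) (R : ℕ) (a : ℕ → ℝ) (r : ℕ) : ℝ :=
  if r < R then c * a r - (n r * (a r - a (r + 1)) + (a r - a (r - 1))) else 0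

/-- The iterates of `radialStep` on the indicator function of the root. -/
noncomputable def radialIter (c : ℝ) (n : ℕ → ℕ) (R k : ℕ) : ℕ → ℝ :=
  (radialStep c n R)^[k] (Pi.single 0 1)

theorem radialIter_succ (c : ℝ) (n : ℕ → ℕ) (R k : ℕ) :
    radialIter c n R (k + 1) = radialStep c n R (radialIter c n R k) :=
  Function.iterate_succ_apply' _ _ _

theorem radialIter_eq_zero (c : ℝ) (n : ℕ → ℕ) {R : ℕ} (hR : 0 < R) (k : ℕ) {r : ℕ}
    (hr : R ≤ r) : radialIter c n R k r = 0 := by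
  cases k with
  | zero => simp [radialIter, show r ≠ 0 by omega]
  | succ k => rw [radialIter_succ, radialStep, if_neg (by omega)]

/-- For `r + 1 < R` the drop of the new profile from `r` to `r + 1` is `(c - n r - 1)(a r - a (r+1))
+ n (r+1) (a (r+1) - a (r+2)) + (a (r-1) - a r)`, a sum of nonnegative terms. At the cut-off only
nonnegativity is needed. -/
theorem radialIter_antitone {c : ℝ} {n : ℕ → ℕ} {R : ℕ} (hR : 0 < R)
    (hc : ∀ r < R, (n r : ℝ) + 1 ≤ c) (k : ℕ) : Antitone (radialIter c n R k) := by
  induction k with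
  | zero =>
    refine antitone_nat_of_succ_le fun r => ?_
    simp only [radialIter, Function.iterate_zero, id, Pi.single_apply, if_neg (Nat.succ_ne_zero r)]
    split_ifs <;> norm_num
  | succ k ih =>
    have hnn : ∀ r, 0 ≤ radialIter c n R k r := fun r => by
      rw [← radialIter_eq_zero c n hR k (le_max_right r R)]
      exact ih (le_max_left r R)
    set a := radialIter c n R k with ha
    refine antitone_nat_of_succ_le fun r => ?_
    rw [radialIter_succ, ← ha, radialStep, radialStep]
    have h0 : a r ≤ a (r - 1) := ih (by omega)
    have h1 : a (r + 1) ≤ a r := ih (by omega)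
    have h2 : a (r + 1 + 1) ≤ a (r + 1) := ih (by omega)
    by_cases hr : r < R
    · rw [if_pos hr]
      have hcr := hc r hr
      by_cases hr' : r + 1 < R
      · rw [if_pos hr', Nat.add_sub_cancel]
        have e1 := mul_nonneg (sub_nonneg.mpr hcr) (sub_nonneg.mpr h1)
        have e2 := mul_nonneg (Nat.cast_nonneg (α := ℝ) (n (r + 1))) (sub_nonneg.mpr h2)
        linarith
      · rw [if_neg hr']
        have e1 := mul_nonneg (sub_nonneg.mpr hcr) (hnn r)
        have e2 := mul_nonneg (Nat.cast_nonneg (α := ℝ) (n r)) (hnn (r + 1))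
        have := hnn (r - 1)
        linarith
    · rw [if_neg hr, if_neg (by omega)]

theorem radialIter_zero_dist [DecidableEq V] (hG : G.Connected) (c : ℝ) (n : ℕ → ℕ) (R : ℕ)
    (o x : V) : radialIter c n R 0 (G.dist o x) = (Pi.single o 1 : V → ℝ) x := by
  simp only [radialIter, Function.iterate_zero, id, Pi.single_apply, hG.dist_eq_zero_iff,
    eq_comm]

/-- Iterates of `c - Δ` on a tree dominate those on a model tree that branches at least as
much. -/
theorem radialIter_le_heatIter [G.LocallyFinite] (hG : G.IsTree) {o : V} {n : ℕ → ℕ}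
    (hn : ∀ x, G.degree x ≤ if G.dist o x = 0 then n 0 else n (G.dist o x) + 1)
    {c : ℝ} {R : ℕ} (hR : 0 < R) (hc : ∀ r ≤ R, (n r : ℝ) + 1 ≤ c) (k : ℕ) (x : V) :
    radialIter c n R k (G.dist o x) ≤ heatIter G c (ball G o R) o k x := by
  classical
  have hdeg : ∀ x ∈ ball G o R, (G.degree x : ℝ) ≤ c := fun x hx => by
    refine le_trans ?_ (hc _ ((mem_ball_iff_dist hG.connected).mp hx))
    have := hn x
    split_ifs at this with h
    · rw [h]
      exact_mod_cast this.trans (Nat.le_succ _)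
    · exact_mod_cast this
  induction k generalizing x with
  | zero =>
    rw [radialIter_zero_dist hG.connected]
    refine le_of_eq ?_
    simp [heatIter, Pi.single_apply]
  | succ k ih =>
    by_cases hx : G.dist o x < R
    · have hxi := mem_interior_ball_of_dist_lt hG.connected hx
      have hdx := hdeg x ((mem_ball_iff_dist hG.connected).mpr hx.le)
      -- `m` is the number of children of `x`.
      obtain ⟨m, hm, hmn⟩ : ∃ m : ℕ, (G.degree x = if G.dist o x = 0 then m else m + 1) ∧
          m ≤ n (G.dist o x) := by
        have hnx := hn x
        by_cases h0 : G.dist o x = 0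
        · rw [if_pos h0] at hnx
          exact ⟨G.degree x, by rw [if_pos h0], by rwa [h0]⟩
        · rw [if_neg h0] at hnx
          obtain ⟨z, hz, -⟩ := exists_adj_dist_add_one_eq hG.connected h0
          have : 0 < G.degree x := (G.degree_pos_iff_exists_adj x).mpr ⟨z, hz⟩
          exact ⟨G.degree x - 1, by rw [if_neg h0]; omega, by omega⟩
      have hanti := radialIter_antitone hR (fun r hr => hc r hr.le) k
        (Nat.le_succ (G.dist o x))
      rw [heatIter_succ, heatStep, if_pos hxi, radialIter_succ, radialStep, if_pos hx]
      -- Since the profile decreases outward, replacing `n` by the smaller `m` subtracts less.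
      calc _ ≤ c * radialIter c n R k (G.dist o x) -
              (m * (radialIter c n R k (G.dist o x) - radialIter c n R k (G.dist o x + 1)) +
              (radialIter c n R k (G.dist o x) - radialIter c n R k (G.dist o x - 1))) := by
            have h1 : (m : ℝ) ≤ n (G.dist o x) := by exact_mod_cast hmn
            have := mul_le_mul_of_nonneg_right h1 (sub_nonneg.mpr hanti)
            linarith
        _ = (c - G.degree x) * radialIter c n R k (G.dist o x) +
              ∑ y ∈ G.neighborFinset x, radialIter c n R k (G.dist o y) := by
            rw [← laplacian_comp_dist hG o x hm]
            exact mul_sub_laplacian G c (fun y => radialIter c n R k (G.dist o y)) x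
        _ ≤ (c - G.degree x) * heatIter G c (ball G o R) o k x +
              ∑ y ∈ G.neighborFinset x, heatIter G c (ball G o R) o k y :=
            add_le_add (mul_le_mul_of_nonneg_left (ih x) (by linarith))
              (Finset.sum_le_sum fun y _ => ih y)
        _ = _ := (mul_sub_laplacian G c _ x).symm
    -- A leaf of `G` on the sphere of radius `R` is interior to the ball, so the right side need not
    -- vanish here.
    · rw [radialIter_eq_zero c n hR _ (by omega)]
      exact heatIter_nonneg G hdeg o _ x

/-! ### Radiality on the model tree -/

namespace IsModelTree

variable [G.LocallyFinite] {o : V} {n : ℕ → ℕ}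

theorem degree_eq_ite (h : IsModelTree G o n) (x : V) :
    G.degree x = if G.dist o x = 0 then n (G.dist o x) else n (G.dist o x) + 1 := by
  split_ifs with h0
  · rw [h0, ← h.degree_root, h.isTree.connected.dist_eq_zero_iff.mp h0]
  · exact h.degree_eq x (Nat.pos_of_ne_zero h0)

/-- The number of children depends only on the level. Level `r + 1` is nonempty in an infinite tree,
so some vertex of level `r` has a child, and hence all do. -/
theorem exists_adj_dist_eq_add_one [Infinite V] (h : IsModelTree G o n) (x : V) :
    ∃ y, G.Adj x y ∧ G.dist o y = G.dist o x + 1 := by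
  obtain ⟨y, hy⟩ := exists_dist_eq h.isTree.connected o (G.dist o x + 1)
  obtain ⟨z, hz, hz'⟩ := exists_adj_dist_add_one_eq h.isTree.connected
    (o := o) (x := y) (by omega)
  have hzx : G.dist o z = G.dist o x := by omega
  have hsum : ∀ w, G.dist o w = G.dist o x → ∑ y ∈ G.neighborFinset w,
      (if G.dist o y = G.dist o x + 1 then (1 : ℝ) else 0) = n (G.dist o x) := fun w hw => by
    rw [sum_neighbor_dist h.isTree o w (h.degree_eq_ite w)
      (fun r => if r = G.dist o x + 1 then (1 : ℝ) else 0), hw]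
    simp [show ¬ G.dist o x - 1 = G.dist o x + 1 by omega]
  have hpos : 0 < ∑ y ∈ G.neighborFinset z,
      (if G.dist o y = G.dist o x + 1 then (1 : ℝ) else 0) := by
    refine Finset.sum_pos' (fun _ _ => by split_ifs <;> norm_num) ⟨y, ?_, ?_⟩
    · exact (G.mem_neighborFinset z y).mpr hz.symm
    · rw [if_pos hy]
      norm_num
  rw [hsum z hzx, ← hsum x rfl] at hpos
  by_contra! hne
  refine hpos.ne' (Finset.sum_eq_zero fun y hy => if_neg (hne y ?_))
  exact (G.mem_neighborFinset x y).mp hy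

/-- A vertex on the bounding sphere has a child outside the ball, so the Dirichlet cut-off is
radial. -/
theorem mem_interior_ball_iff [Infinite V] (h : IsModelTree G o n) {x : V} {R : ℕ} :
    x ∈ interior G (ball G o R) ↔ G.dist o x < R := by
  refine ⟨fun hx => ?_, mem_interior_ball_of_dist_lt h.isTree.connected⟩
  obtain ⟨y, hy, hy'⟩ := h.exists_adj_dist_eq_add_one x
  simp only [interior, Finset.mem_filter] at hx
  have := (mem_ball_iff_dist h.isTree.connected).mp (hx.2 y hy)
  omega

theorem heatIter_eq_radialIter [Infinite V] (h : IsModelTree G o n) (c : ℝ) (R k : ℕ) :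
    heatIter G c (ball G o R) o k = fun x => radialIter c n R k (G.dist o x) := by
  classical
  induction k with
  | zero =>
    ext x
    rw [radialIter_zero_dist h.isTree.connected]
    simp [heatIter, Pi.single_apply]
  | succ k ih =>
    ext x
    rw [heatIter_succ, ih, radialIter_succ, heatStep, radialStep,
      laplacian_comp_dist h.isTree o x (h.degree_eq_ite x)]
    simp only [h.mem_interior_ball_iff]

end IsModelTree

/-- The heat kernel of the model tree is dominated by that of a tree that branches less. -/
theorem heatKernel_model_le {W : Type*} {H : SimpleGraph W} [H.LocallyFinite] [Infinite W]
    [G.LocallyFinite] (hG : G.IsTree) {x₀ : V} {o : W} {n : ℕ → ℕ} (hH : IsModelTree H o n)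
    (hn : ∀ x, G.degree x ≤ if G.dist x₀ x = 0 then n 0 else n (G.dist x₀ x) + 1)
    {t : ℝ} (ht : 0 ≤ t) {x : V} {y : W} (hxy : G.dist x₀ x = H.dist o y) :
    heatKernel H o t o y ≤ heatKernel G x₀ t x₀ x := by
  refine le_of_tendsto_of_tendsto (tendsto_dirichletHeatKernel H o ht y)
    (tendsto_dirichletHeatKernel G x₀ ht x) ?_
  filter_upwards [Filter.eventually_gt_atTop 0] with R hR
  -- A single `c`, depending on `R`, must serve both trees; the sum dominates `n r + 1` for each `r
  -- ≤ R`.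
  refine dirichletHeatKernel_le H G (∑ r ∈ Finset.range (R + 1), ((n r : ℝ) + 1)) ht
    (mem_interior_ball_of_edist_lt H (by simpa using hR))
    (mem_interior_ball_of_edist_lt G (by simpa using hR)) fun k => ?_
  rw [hH.heatIter_eq_radialIter]
  simp only [← hxy]
  exact radialIter_le_heatIter hG hn hR (fun r hr => Finset.single_le_sum
    (f := fun r => (n r : ℝ) + 1) (fun _ _ => by positivity)
    (Finset.mem_range.mpr (Nat.lt_succ_of_le hr))) k x

end Tree

end GraphHeat

theorem mainTheorem7 {V W : Type*} [Infinite V] [Infinite W]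
    (T : SimpleGraph V) [T.LocallyFinite] (hT : T.IsTree) (x₀ : V)
    (Tn : SimpleGraph W) [Tn.LocallyFinite] (o : W) (n : ℕ → ℕ)
    (hTn : GraphHeat.IsModelTree Tn o n)
    (hroot : T.degree x₀ ≤ n 0)
    (hM : ∀ r : ℕ, 0 < r → GraphHeat.maxValence T x₀ r ≤ n r + 1) :
    ∃ ρ : ℝ → ℕ → ℝ,
      (∀ t : ℝ, 0 ≤ t → ∀ r : ℕ, ∀ y ∈ GraphHeat.sphere Tn o r,
        GraphHeat.heatKernel Tn o t o y = ρ t r) ∧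
      (∀ t : ℝ, 0 ≤ t → ∀ r : ℕ, ∀ x ∈ GraphHeat.sphere T x₀ r,
        ρ t r ≤ GraphHeat.heatKernel T x₀ t x₀ x) := by
  choose y hy using GraphHeat.exists_dist_eq hTn.isTree.connected o
  have hmodel : ∀ z, Tn.degree z ≤ if Tn.dist o z = 0 then n 0 else n (Tn.dist o z) + 1 :=
    fun z => by
      rw [hTn.degree_eq_ite z]
      split_ifs with h
      · rw [h]
      · exact le_rfl
  have hdeg : ∀ x, T.degree x ≤ if T.dist x₀ x = 0 then n 0 else n (T.dist x₀ x) + 1 :=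
    fun x => by
      split_ifs with h
      · rwa [← hT.connected.dist_eq_zero_iff.mp h]
      · exact le_trans (Finset.le_sup (f := fun x => T.degree x)
          ((GraphHeat.mem_sphere_iff_dist hT.connected).mpr rfl)) (hM _ (Nat.pos_of_ne_zero h))
  refine ⟨fun t r => GraphHeat.heatKernel Tn o t o (y r), fun t ht r z hz => ?_,
    fun t ht r x hx => ?_⟩
  · rw [GraphHeat.mem_sphere_iff_dist hTn.isTree.connected] at hz
    -- Radiality comes from comparing the model tree with itself in both directions.
    exact le_antisymm
      (GraphHeat.heatKernel_model_le hTn.isTree hTn hmodel ht ((hy r).trans hz.symm))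
      (GraphHeat.heatKernel_model_le hTn.isTree hTn hmodel ht (hz.trans (hy r).symm))
  · rw [GraphHeat.mem_sphere_iff_dist hT.connected] at hx
    exact GraphHeat.heatKernel_model_le hT hTn hdeg ht (hx.trans (hy r).symm)
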